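/- Let $1\le d\le n$, and let $\mathcal M\subset\mathbb R^n$ be a compact, oriented $d$-dimensional manifold mesh: the union of the (closed) simplices of a finite simplicial complex $\mathcal K$ in $\mathbb R^n$ in which every simplex is a face of a $d$-simplex, such that $\mathcal M$ is a topological $d$-manifold with (possibly empty) boundary, and whose $d$-simplices carry a consistent orientation (two distinct $d$-simplices with a common $(d-1)$-face induce opposite orientations on it). Let $\partial\mathcal M$ be the boundary mesh, that is, the union of the $(d-1)$-simplices of $\mathcal K$ contained in exactly one $d$-simplex, and let $\operatorname{int}\mathcal M=\mathcal M\setminus\partial\mathcal M$. Let $\Phi:\mathcal M\to\mathbb R^d$ be a simplicial map, i.e. $\Phi$ is continuous and its restriction to each simplex of $\mathcal K$ is affine. Suppose that $\Phi$ is non-degenerate (it is injective on each $d$-simplex) and orientation preserving (it maps each $d$-simplex, with its given orientation, to a positively oriented simplex of $\mathbb R^d$). Then $\Phi$ is an open map on the interior of $\mathcal M$: for every $U\subset\operatorname{int}\mathcal M$ that is open in $\operatorname{int}\mathcal M$, the image $\Phi(U)$ is open in $\mathbb R^d$. -/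

import Mathlib

open Geometry

namespace SimplicialMesh

/-- `n`-dimensional Euclidean space. -/
abbrev Euc (n : ℕ) : Type := EuclideanSpace ℝ (Fin n)

variable {n : ℕ}

/-- The `ℓ`-faces of a simplicial complex (faces are stored through their vertex sets). -/
def facesOfDim (K : SimplicialComplex ℝ (Euc n)) (l : ℕ) : Set (Finset (Euc n)) :=
  {s | s ∈ K.faces ∧ s.card = l + 1}

/-- `K` is a compact `d`-dimensional manifold mesh: a finite simplicial complex, each of whose
faces is a face of a `d`-face, and whose underlying space is a topological `d`-manifold with
(possibly empty) boundary, i.e. has an atlas of charts onto open subsets of the closed half-space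
of dimension `d`. -/
structure IsManifoldMesh (K : SimplicialComplex ℝ (Euc n)) (d : ℕ) [NeZero d] : Prop where
  finite : K.faces.Finite
  pure : ∀ s ∈ K.faces, ∃ t ∈ facesOfDim K d, s ⊆ t
  manifold : Nonempty (ChartedSpace (EuclideanHalfSpace d) K.space)

/-- The boundary of a `d`-dimensional mesh: the union of the (closed) `(d-1)`-faces that are
contained in exactly one `d`-face. The `(d-1)`-faces are the faces with `d` vertices. -/
def meshBoundary (K : SimplicialComplex ℝ (Euc n)) (d : ℕ) : Set (Euc n) :=
  ⋃ t ∈ {t | t ∈ K.faces ∧ t.card = d ∧ ∃! s, s ∈ facesOfDim K d ∧ t ⊆ s},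
    convexHull ℝ (t : Set (Euc n))

/-- The interior of a mesh: the points of the mesh that are not on its boundary. -/
def meshInterior (K : SimplicialComplex ℝ (Euc n)) (d : ℕ) : Set (Euc n) :=
  K.space \ meshBoundary K d

/-- `v` is an ordering `(v 0, …, v d)` of the vertices of some `d`-face of `K`. -/
def IsVertexOrdering (K : SimplicialComplex ℝ (Euc n)) {d : ℕ} (v : Fin (d + 1) → Euc n) : Prop :=
  ∃ s ∈ facesOfDim K d, Set.range v = (s : Set (Euc n))

/-- A consistent orientation of the `d`-faces of a `d`-dimensional mesh. The orientation of a
`d`-face is one of the two classes of orderings of its vertices modulo even permutations; it is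
recorded by `sign v = 1` if the ordering `v` is positive and `sign v = -1` if it is negative
(the value on tuples which do not order a `d`-face is irrelevant). -/
structure ConsistentOrientation (K : SimplicialComplex ℝ (Euc n)) (d : ℕ) where
  sign : (Fin (d + 1) → Euc n) → ℤˣ
  /-- Permuting the vertices changes the class by the sign of the permutation. -/
  sign_perm : ∀ v, IsVertexOrdering K v → ∀ p : Equiv.Perm (Fin (d + 1)),
    sign (v ∘ p) = Equiv.Perm.sign p * sign v
  /-- Two different `d`-faces with a common `(d-1)`-face induce opposite orientations on it:
  if the vertices of the two are listed so that they differ at the `i`-th place only, then one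
  listing is positive and the other is negative. -/
  sign_adjacent : ∀ v w, IsVertexOrdering K v → IsVertexOrdering K w → ∀ i,
    (∃ j, j ≠ i) → (∀ j, j ≠ i → v j = w j) → v i ≠ w i → sign w = -sign v

/-- A simplicial map on the underlying space of `K` (values elsewhere are irrelevant):
continuous, and affine on each face. -/
structure IsSimplicialMap (K : SimplicialComplex ℝ (Euc n)) {m : ℕ} (Φ : Euc n → Euc m) :
    Prop where
  continuousOn : ContinuousOn Φ K.space
  affine : ∀ s ∈ K.faces, ∃ A : Euc n →ᵃ[ℝ] Euc m, Set.EqOn Φ A (convexHull ℝ (s : Set (Euc n)))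

/-- A simplicial map into `ℝ^d` is non-degenerate if it degenerates no `d`-face, i.e. its affine
restriction to each `d`-face is injective. -/
def IsNondegenerate (K : SimplicialComplex ℝ (Euc n)) {d : ℕ} (Φ : Euc n → Euc d) : Prop :=
  ∀ s ∈ facesOfDim K d, Set.InjOn Φ (convexHull ℝ (s : Set (Euc n)))

/-- A simplicial map into `ℝ^d` is orientation preserving if it maps each positively ordered
`d`-face `(v 0, …, v d)` to a positively oriented simplex of `ℝ^d`, i.e. the vectors
`Φ (v 1) - Φ (v 0), …, Φ (v d) - Φ (v 0)` have positive determinant. -/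
def IsOrientationPreserving {K : SimplicialComplex ℝ (Euc n)} {d : ℕ}
    (o : ConsistentOrientation K d) (Φ : Euc n → Euc d) : Prop :=
  ∀ v, IsVertexOrdering K v → o.sign v = 1 →
    0 < (Matrix.of fun i j : Fin d => Φ (v j.succ) i - Φ (v 0) i).det

end SimplicialMesh

open Set Topology

namespace SimplicialMesh

section AffineBases

variable {E : Type*} [NormedAddCommGroup E] [NormedSpace ℝ E]

/-- Affine functions evaluated through barycentric coordinates. -/
lemma map_eq_sum_coord {ι : Type*} [Fintype ι] (b : AffineBasis ι ℝ E) (f : E →ᵃ[ℝ] ℝ) (q : E) :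
    f q = ∑ k, b.coord k q * f (b k) := by
  conv_lhs => rw [← b.affineCombination_coord_eq_self q]
  rw [Finset.map_affineCombination _ _ _ (b.sum_coord_apply_eq_one q),
    Finset.affineCombination_eq_linear_combination _ _ _ (b.sum_coord_apply_eq_one q)]
  rfl

variable {ι : Type*} [Fintype ι]

lemma coord_adjacent {b b' : AffineBasis ι ℝ E} {i : ι} (h : ∀ j, j ≠ i → b' j = b j) (q : E) :
    b.coord i q = b'.coord i q * b.coord i (b' i) := by
  classical
  rw [map_eq_sum_coord b' (b.coord i) q, Finset.sum_eq_single i]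
  · intro k _ hk
    rw [h k hk, b.coord_apply_ne hk.symm, mul_zero]
  · simp

lemma coord_adjacent_of_ne {b b' : AffineBasis ι ℝ E} {i j : ι} (h : ∀ j, j ≠ i → b' j = b j)
    (hj : j ≠ i) (q : E) :
    b.coord j q = b'.coord j q + b'.coord i q * b.coord j (b' i) := by
  classical
  rw [map_eq_sum_coord b' (b.coord j) q, Fintype.sum_eq_add j i hj]
  · rw [h j hj, b.coord_apply_eq, mul_one]
  · rintro k ⟨hkj, hki⟩
    rw [h k hki, b.coord_apply_ne hkj.symm, mul_zero]

lemma exists_near_coord_pos [Nonempty ι] (b : AffineBasis ι ℝ E) {y : E}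
    (hy : y ∈ convexHull ℝ (range b)) {B : Set E} (hB : B ∈ 𝓝 y) :
    ∃ a ∈ B, ∀ i, 0 < b.coord i a := by
  rw [b.convexHull_eq_nonneg_coord] at hy
  let c := Finset.univ.centroid ℝ b
  have hc : ∀ i, 0 < b.coord i c := fun i => by
    rw [b.coord_apply_centroid (Finset.mem_univ i)]
    have : 0 < (Finset.univ : Finset ι).card := Finset.card_pos.mpr Finset.univ_nonempty
    positivity
  have ht : Filter.Tendsto (AffineMap.lineMap (k := ℝ) y c) (𝓝[>] 0) (𝓝 y) := by
    have : Continuous (AffineMap.lineMap (k := ℝ) y c) := AffineMap.lineMap_continuous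
    have h0 := this.tendsto 0
    rw [AffineMap.lineMap_apply_zero] at h0
    exact h0.mono_left nhdsWithin_le_nhds
  obtain ⟨t, htB, ht0, ht1⟩ := ((ht.eventually hB).and
    (Ioo_mem_nhdsGT (zero_lt_one (α := ℝ)))).exists
  refine ⟨_, htB, fun i => ?_⟩
  rw [AffineMap.apply_lineMap, AffineMap.lineMap_apply_ring']
  have h1 := hy i
  have h2 := hc i
  have : t * (b.coord i c - b.coord i y) + b.coord i y
    = t * b.coord i c + (1 - t) * b.coord i y := by ring
  rw [this]
  have : 0 ≤ (1 - t) * b.coord i y := mul_nonneg (by linarith) h1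
  have : 0 < t * b.coord i c := mul_pos ht0 h2
  linarith

variable [FiniteDimensional ℝ E]

/-- The zero set of a nonzero affine function is negligible. -/
lemma volume_zeroSet_affine [MeasurableSpace E] [BorelSpace E]
    (μ : MeasureTheory.Measure E) [μ.IsAddHaarMeasure] (f : E →ᵃ[ℝ] ℝ)
    (hf : ∃ z, f z ≠ 0) : μ {q | f q = 0} = 0 := by
  obtain ⟨z, hz⟩ := hf
  have h := MeasureTheory.Measure.addHaar_affineSubspace μ
    ((AffineSubspace.mk' (0 : ℝ) ⊥).comap f) (by
      intro h
      have : z ∈ (AffineSubspace.mk' (0 : ℝ) ⊥).comap f := h ▸ AffineSubspace.mem_top ℝ E z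
      simp at this
      exact hz this)
  convert h using 2
  ext q
  simp

/-- The complement of finitely many zero sets of nonzero affine functions is dense. -/
lemma dense_forall_affine_ne_zero {κ : Type*} [Countable κ]
    (f : κ → E →ᵃ[ℝ] ℝ) (hf : ∀ k, ∃ z, f k z ≠ 0) : Dense {q | ∀ k, f k q ≠ 0} := by
  borelize E
  let μ : MeasureTheory.Measure E := MeasureTheory.Measure.addHaar
  apply MeasureTheory.Measure.dense_of_ae (μ := μ)
  rw [MeasureTheory.ae_all_iff]
  intro k
  rw [MeasureTheory.ae_iff]
  simpa using volume_zeroSet_affine μ (f k) (hf k)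

/-- Two nondegenerate simplices lying on opposite sides of a common facet cover a neighbourhood of
every point of the relative interior of that facet. -/
lemma union_convexHull_mem_nhds {b b' : AffineBasis ι ℝ E} {i : ι} (h : ∀ j, j ≠ i → b' j = b j)
    (hneg : b.coord i (b' i) < 0) {p : E} (hi : b.coord i p = 0)
    (hpos : ∀ j, j ≠ i → 0 < b.coord j p) :
    convexHull ℝ (range b) ∪ convexHull ℝ (range b') ∈ 𝓝 p := by
  have hi' : b'.coord i p = 0 := by
    have := coord_adjacent h p
    rw [hi, eq_comm, mul_eq_zero] at this
    exact this.resolve_right hneg.ne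
  have e1 : ∀ᶠ q in 𝓝 p, ∀ j, j ≠ i → 0 < b.coord j q := by
    rw [Filter.eventually_all]
    intro j
    by_cases hj : j = i
    · simp [hj]
    · filter_upwards [(continuous_barycentric_coord b j).continuousAt.eventually_const_lt
        (hpos j hj)] with q hq _ using hq
  have e2 : ∀ᶠ q in 𝓝 p, ∀ j, j ≠ i → 0 < b'.coord j q := by
    rw [Filter.eventually_all]
    intro j
    by_cases hj : j = i
    · simp [hj]
    · have : 0 < b'.coord j p := by
        have := coord_adjacent_of_ne h hj p
        rw [hi', zero_mul, add_zero] at this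
        exact this ▸ hpos j hj
      filter_upwards [(continuous_barycentric_coord b' j).continuousAt.eventually_const_lt
        this] with q hq _ using hq
  filter_upwards [e1, e2] with q h1 h2
  rw [b.convexHull_eq_nonneg_coord, b'.convexHull_eq_nonneg_coord]
  have hq := coord_adjacent h q
  rcases le_or_gt 0 (b.coord i q) with h0 | h0
  · left
    intro j
    by_cases hj : j = i
    · exact hj ▸ h0
    · exact (h1 j hj).le
  · right
    intro j
    by_cases hj : j = i
    · subst hj
      by_contra! hc
      nlinarith [mul_pos_of_neg_of_neg hc hneg]
    · exact (h2 j hj).le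

/-- If finitely many nondegenerate simplices contain `y`, and across every facet through `y` each of
them is adjacent to another one on the opposite side of the facet, then they cover a neighbourhood
of `y`. -/
theorem iUnion_convexHull_mem_nhds {T : Type*} [Finite T] [Nonempty ι] [Nonempty T]
    (b : T → AffineBasis ι ℝ E) (y : E)
    (hy : ∀ t, y ∈ convexHull ℝ (range (b t)))
    (hadj : ∀ t i, (b t).coord i y = 0 →
      ∃ t', (∀ j, j ≠ i → b t' j = b t j) ∧ (b t).coord i (b t' i) < 0) :
    ⋃ t, convexHull ℝ (range (b t)) ∈ 𝓝 y := by
  classical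
  set C := ⋃ t, convexHull ℝ (range (b t)) with hC
  have hCc : IsClosed C := isClosed_iUnion_of_finite fun t =>
    (finite_range (b t)).isClosed_convexHull ℝ
  have hyc : ∀ t i, 0 ≤ (b t).coord i y := fun t i => by
    have := hy t
    rw [(b t).convexHull_eq_nonneg_coord] at this
    exact this i
  obtain ⟨r, hr, hrB⟩ : ∃ r > 0, ∀ q ∈ Metric.ball y r, ∀ t i,
      0 < (b t).coord i y → 0 < (b t).coord i q := by
    have : ∀ᶠ q in 𝓝 y, ∀ t i, 0 < (b t).coord i y → 0 < (b t).coord i q := by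
      simp only [Filter.eventually_all]
      intro t i h
      exact (continuous_barycentric_coord (b t) i).continuousAt.eventually_const_lt h
    exact Metric.eventually_nhds_iff_ball.1 this
  set B := Metric.ball y r with hB
  -- away from the codimension two faces, the union is open near `y`
  have hloc : ∀ p ∈ C, p ∈ B → (∀ t i j, i ≠ j → (b t).coord i p = 0 → (b t).coord j p ≠ 0) →
      p ∈ interior C := by
    intro p hp hpB hgen
    obtain ⟨t, ht⟩ := mem_iUnion.1 hp
    have ht' := ht
    rw [(b t).convexHull_eq_nonneg_coord] at ht'
    by_cases h : ∃ i, (b t).coord i p = 0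
    · obtain ⟨i, hi⟩ := h
      have hiy : (b t).coord i y = 0 := by
        by_contra hne
        exact (hrB p hpB t i (lt_of_le_of_ne (hyc t i) (Ne.symm hne))).ne' hi
      obtain ⟨t', h1, h2⟩ := hadj t i hiy
      rw [mem_interior_iff_mem_nhds]
      refine Filter.mem_of_superset (union_convexHull_mem_nhds h1 h2 hi fun j hj =>
        lt_of_le_of_ne (ht' j) (Ne.symm (hgen t i j hj.symm hi))) ?_
      exact union_subset (subset_iUnion (fun t => convexHull ℝ (range (b t))) t)
        (subset_iUnion (fun t => convexHull ℝ (range (b t))) t')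
    · push Not at h
      refine interior_mono (subset_iUnion (fun t => convexHull ℝ (range (b t))) t) ?_
      rw [(b t).interior_convexHull]
      exact fun i => lt_of_le_of_ne (ht' i) (Ne.symm (h i))
  -- a generic starting point
  obtain ⟨a, haB, haC, ha⟩ : ∃ a ∈ B, a ∈ interior C ∧ ∀ t i, (b t).coord i a ≠ 0 := by
    obtain ⟨t⟩ := ‹Nonempty T›
    obtain ⟨a, haB, ha⟩ := exists_near_coord_pos (b t) (hy t) (Metric.ball_mem_nhds y hr)
    have hd := dense_forall_affine_ne_zero (fun k : T × ι => (b k.1).coord k.2)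
      fun k => ⟨b k.1 k.2, by simp⟩
    have ho : IsOpen (B ∩ interior C) := Metric.isOpen_ball.inter isOpen_interior
    obtain ⟨a', h1, h2⟩ := hd.inter_open_nonempty _ ho ⟨a, haB, by
      refine interior_mono (subset_iUnion (fun t => convexHull ℝ (range (b t))) t) ?_
      rw [(b t).interior_convexHull]
      exact ha⟩
    exact ⟨a', h1.1, h1.2, fun t i => h2 (t, i)⟩
  refine Filter.mem_of_superset (Metric.ball_mem_nhds y hr) ?_
  -- generic points are joined to `a` by segments missing the codimension two faces
  let H : T × {ij : ι × ι // ij.1 ≠ ij.2} → E →ᵃ[ℝ] ℝ := fun k =>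
    (b k.1).coord k.2.1.2 a • (b k.1).coord k.2.1.1 - (b k.1).coord k.2.1.1 a • (b k.1).coord k.2.1.2
  have hd : Dense {q | ∀ k, H k q ≠ 0} := dense_forall_affine_ne_zero H fun ⟨t, ⟨i, j⟩, hij⟩ =>
    ⟨b t i, by
      have : (b t).coord j (b t i) = 0 := (b t).coord_apply_ne (Ne.symm hij)
      simpa [H, this] using ha t j⟩
  have hsub : B ∩ {q | ∀ k, H k q ≠ 0} ⊆ C := by
    rintro q ⟨hqB, hq⟩
    have hseg : segment ℝ a q ⊆ interior C := by
      apply (convex_segment a q).isPreconnected.subset_of_closure_inter_subset isOpen_interior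
        ⟨a, left_mem_segment ℝ a q, haC⟩
      rintro p ⟨hpC, hp⟩
      refine hloc p (closure_minimal interior_subset hCc hpC)
        ((convex_ball y r).segment_subset haB hqB hp) fun t i j hij h1 h2 => ?_
      rw [segment_eq_image_lineMap] at hp
      obtain ⟨s, -, rfl⟩ := hp
      rw [AffineMap.apply_lineMap, AffineMap.lineMap_apply_ring'] at h1 h2
      refine hq (t, ⟨(i, j), hij⟩) ?_
      have hs : s ≠ 0 := by
        rintro rfl
        exact ha t i (by simpa using h1)
      change (b t).coord j a * (b t).coord i q - (b t).coord i a * (b t).coord j q = 0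
      apply mul_left_cancel₀ hs
      linear_combination (b t).coord j a * h1 - (b t).coord i a * h2
    exact interior_subset (hseg (right_mem_segment ℝ a q))
  calc B ⊆ closure (B ∩ {q | ∀ k, H k q ≠ 0}) :=
        hd.open_subset_closure_inter Metric.isOpen_ball
    _ ⊆ C := closure_minimal hsub hCc

end AffineBases

variable {n : ℕ}

section Orientation

variable {d : ℕ}

/-- The matrix with rows `(1, p i)`. -/
def homogMatrix (p : Fin (d + 1) → Euc d) : Matrix (Fin (d + 1)) (Fin (d + 1)) ℝ :=
  Matrix.of fun i => Fin.cons 1 (p i)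

lemma homogMatrix_det (p : Fin (d + 1) → Euc d) :
    (homogMatrix p).det = (Matrix.of fun i j : Fin d => p j.succ i - p 0 i).det := by
  let B : Matrix (Fin (d + 1)) (Fin (d + 1)) ℝ :=
    Matrix.of fun i j => homogMatrix p i j - (if i = 0 then 0 else 1) * homogMatrix p 0 j
  have h : (homogMatrix p).det = B.det := by
    refine Matrix.det_eq_of_forall_row_eq_smul_add_const (fun i => if i = 0 then 0 else 1) 0
      (by simp) fun i j => ?_
    simp [B]
  rw [h, Matrix.det_succ_column_zero, Finset.sum_eq_single 0]
  · rw [← Matrix.det_transpose]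
    simp only [Fin.val_zero, pow_zero, one_mul]
    have : B 0 0 = 1 := by simp [B, homogMatrix]
    rw [this, one_mul]
    congr 1
    ext i j
    simp [B, homogMatrix]
  · intro i _ hi
    simp [B, homogMatrix, hi]
  · simp

lemma homogMatrix_det_comp_perm (p : Fin (d + 1) → Euc d) (e : Equiv.Perm (Fin (d + 1))) :
    (homogMatrix (p ∘ e)).det = Equiv.Perm.sign e * (homogMatrix p).det :=
  Matrix.det_permute e (homogMatrix p)

lemma affineIndependent_of_det_ne_zero {p : Fin (d + 1) → Euc d}
    (h : (homogMatrix p).det ≠ 0) : AffineIndependent ℝ p := by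
  rw [affineIndependent_iff_of_fintype]
  intro w hw hs
  rw [Finset.univ.weightedVSub_eq_linear_combination hw] at hs
  refine congrFun (Matrix.eq_zero_of_vecMul_eq_zero h (v := w) ?_)
  ext j
  refine Fin.cases ?_ (fun k => ?_) j
  · simpa [Matrix.vecMul, dotProduct, homogMatrix] using hw
  · have := congrArg (fun v : Euc d => v k) hs
    simpa [Matrix.vecMul, dotProduct, homogMatrix] using this

/-- The affine basis formed by the vertices of a nondegenerate `d`-simplex in `ℝ^d`. -/
noncomputable def basisOfDet (p : Fin (d + 1) → Euc d) (h : (homogMatrix p).det ≠ 0) :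
    AffineBasis (Fin (d + 1)) ℝ (Euc d) where
  toFun := p
  ind' := affineIndependent_of_det_ne_zero h
  tot' := by
    rw [(affineIndependent_of_det_ne_zero h).affineSpan_eq_top_iff_card_eq_finrank_add_one]
    simp

@[simp]
lemma basisOfDet_apply (p : Fin (d + 1) → Euc d) (h : (homogMatrix p).det ≠ 0)
    (i : Fin (d + 1)) : basisOfDet p h i = p i := rfl

lemma coe_basisOfDet (p : Fin (d + 1) → Euc d) (h : (homogMatrix p).det ≠ 0) :
    ⇑(basisOfDet p h) = p := rfl

/-- Cramer's rule for barycentric coordinates. -/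
lemma homogMatrix_det_of_eq_off {p q : Fin (d + 1) → Euc d} (h : (homogMatrix p).det ≠ 0)
    {i : Fin (d + 1)} (hpq : ∀ j, j ≠ i → q j = p j) :
    (homogMatrix q).det = (basisOfDet p h).coord i (q i) * (homogMatrix p).det := by
  set b := basisOfDet p h
  have h1 := b.sum_coord_apply_eq_one (q i)
  have h2 := b.linear_combination_coord_eq_self (q i)
  rw [← smul_eq_mul, ← Matrix.det_updateRow_sum (homogMatrix p) i fun k => b.coord k (q i)]
  congr 1
  ext j l
  by_cases hj : j = i
  · subst hj
    rw [Matrix.updateRow_self]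
    refine Fin.cases ?_ (fun k => ?_) l
    · simp [homogMatrix, h1]
    · have := congrArg (fun v : Euc d => v k) h2
      simpa [homogMatrix, b] using this.symm
  · rw [Matrix.updateRow_ne hj]
    simp [homogMatrix, hpq j hj]

end Orientation

section Mesh

variable {K : SimplicialComplex ℝ (Euc n)} {d : ℕ}

lemma IsVertexOrdering.comp_perm {v : Fin (d + 1) → Euc n} (hv : IsVertexOrdering K v)
    (e : Equiv.Perm (Fin (d + 1))) : IsVertexOrdering K (v ∘ e) := by
  obtain ⟨s, hs, h⟩ := hv
  exact ⟨s, hs, by rw [e.surjective.range_comp, h]⟩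

lemma IsVertexOrdering.injective {v : Fin (d + 1) → Euc n} (hv : IsVertexOrdering K v) :
    Function.Injective v := by
  classical
  obtain ⟨s, hs, h⟩ := hv
  have h1 : Finset.univ.image v = s := by
    apply Finset.coe_injective
    simpa using h
  rw [← injOn_univ, ← Finset.coe_univ, ← Finset.card_image_iff, h1, hs.2, Finset.card_fin]

lemma exists_vertexOrdering {s : Finset (Euc n)} (hs : s ∈ facesOfDim K d) :
    ∃ v : Fin (d + 1) → Euc n, IsVertexOrdering K v ∧ range v = (s : Set (Euc n)) := by
  let e := (s.equivFinOfCardEq hs.2).symm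
  have h : range (fun i => (e i : Euc n)) = s := by
    ext x
    constructor
    · rintro ⟨i, rfl⟩
      exact (e i).2
    · intro hx
      exact ⟨e.symm ⟨x, hx⟩, by simp⟩
  exact ⟨_, ⟨s, hs, h⟩, h⟩

/-- The orientation sign of a `d`-face agrees with the sign of its image in `ℝ^d`. -/
lemma sign_mul_det_pos [NeZero d] {o : ConsistentOrientation K d} {Φ : Euc n → Euc d}
    (hor : IsOrientationPreserving o Φ) {v : Fin (d + 1) → Euc n} (hv : IsVertexOrdering K v) :
    0 < ((o.sign v : ℤ) : ℝ) * (homogMatrix (Φ ∘ v)).det := by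
  rcases Int.units_eq_one_or (o.sign v) with h | h
  · have := hor v hv h
    rw [h, homogMatrix_det]
    simpa using this
  · let e : Equiv.Perm (Fin (d + 1)) := Equiv.swap 0 (Fin.last d)
    have hne : (0 : Fin (d + 1)) ≠ Fin.last d := by
      simp [Fin.ext_iff, (NeZero.ne d).symm]
    have hs : o.sign (v ∘ e) = 1 := by
      rw [o.sign_perm v hv e, Equiv.Perm.sign_swap hne, h]
      rfl
    have h1 : 0 < (homogMatrix (Φ ∘ (v ∘ e))).det := by
      rw [homogMatrix_det]
      exact hor _ (hv.comp_perm e) hs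
    rw [← Function.comp_assoc, homogMatrix_det_comp_perm, Equiv.Perm.sign_swap hne] at h1
    rw [h]
    simpa using h1

lemma homogMatrix_det_ne_zero [NeZero d] {o : ConsistentOrientation K d} {Φ : Euc n → Euc d}
    (hor : IsOrientationPreserving o Φ) {v : Fin (d + 1) → Euc n} (hv : IsVertexOrdering K v) :
    (homogMatrix (Φ ∘ v)).det ≠ 0 :=
  right_ne_zero_of_mul (sign_mul_det_pos hor hv).ne'

/-- Adjacent `d`-faces are mapped to opposite sides of the image of their common facet. -/
lemma coord_neg_of_adjacent [NeZero d] {o : ConsistentOrientation K d} {Φ : Euc n → Euc d}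
    (hor : IsOrientationPreserving o Φ) {v w : Fin (d + 1) → Euc n} (hv : IsVertexOrdering K v)
    (hw : IsVertexOrdering K w) {i : Fin (d + 1)} (hvw : ∀ j, j ≠ i → w j = v j)
    (hi : w i ≠ v i) :
    (basisOfDet (Φ ∘ v) (homogMatrix_det_ne_zero hor hv)).coord i (Φ (w i)) < 0 := by
  have hex : ∃ j, j ≠ i := by
    have : Nontrivial (Fin (d + 1)) :=
      Fin.nontrivial_iff_two_le.2 (by have := NeZero.pos d; omega)
    exact exists_ne i
  have hs := o.sign_adjacent v w hv hw i hex (fun j hj => (hvw j hj).symm) hi.symm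
  have h1 := sign_mul_det_pos hor hv
  have h2 := sign_mul_det_pos hor hw
  have h3 := homogMatrix_det_of_eq_off (homogMatrix_det_ne_zero hor hv) (q := Φ ∘ w) (i := i)
    fun j hj => by simp [hvw j hj]
  rw [hs, h3] at h2
  by_contra! hc
  have := mul_nonneg hc h1.le
  simp only [Function.comp_apply, Units.val_neg, Int.cast_neg] at h2
  linarith

lemma isClosed_meshBoundary (hfin : K.faces.Finite) : IsClosed (meshBoundary K d) := by
  refine (hfin.subset fun t ht => ht.1).isClosed_biUnion fun t _ => ?_
  exact t.finite_toSet.isClosed_convexHull ℝ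

/-- Across every facet through a point of the interior there is another `d`-face. -/
lemma exists_adjacent [NeZero d] {x : Euc n} (hx : x ∉ meshBoundary K d) {v : Fin (d + 1) → Euc n}
    (hv : IsVertexOrdering K v) {i : Fin (d + 1)} (hxi : x ∈ convexHull ℝ (v '' {i}ᶜ)) :
    ∃ w : Fin (d + 1) → Euc n, IsVertexOrdering K w ∧ (∀ j, j ≠ i → w j = v j) ∧ w i ≠ v i := by
  classical
  have hinj := hv.injective
  obtain ⟨s, hs, hvs⟩ := hv
  have his : v i ∈ s := by
    rw [← Finset.mem_coe, ← hvs]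
    exact mem_range_self i
  set t := s.erase (v i) with ht
  have htc : t.card = d := by rw [ht, Finset.card_erase_of_mem his, hs.2]; rfl
  have htne : t.Nonempty := Finset.card_pos.1 (htc ▸ NeZero.pos d)
  have htv : (t : Set (Euc n)) = v '' {i}ᶜ := by
    rw [ht, Finset.coe_erase, ← hvs, Set.image_compl_eq_range_sdiff_image hinj, image_singleton]
  have htK : t ∈ K.faces := K.down_closed hs.1 (Finset.erase_subset _ _) htne
  have hex : ∃ s' ∈ facesOfDim K d, t ⊆ s' ∧ s' ≠ s := by
    by_contra! hc
    refine hx (mem_biUnion (x := t) ⟨htK, htc, s, ⟨hs, Finset.erase_subset _ _⟩, ?_⟩ (htv ▸ hxi))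
    rintro s' ⟨h1, h2⟩
    exact hc s' h1 h2
  obtain ⟨s', hs', hts', hne⟩ := hex
  obtain ⟨u, hu, hus'⟩ : ∃ u, u ∉ t ∧ insert u t = s' := by
    have : t.card + 1 = s'.card := by rw [htc, hs'.2]
    obtain ⟨u, hu, h⟩ := (Finset.covBy_iff_card_sdiff_eq_one.2 ⟨hts', by
      rw [Finset.card_sdiff_of_subset hts']; omega⟩).exists_finset_insert
    exact ⟨u, hu, h⟩
  have hui : u ≠ v i := by
    rintro rfl
    exact hne (hus' ▸ Finset.insert_erase his)
  refine ⟨Function.update v i u, ⟨s', hs', ?_⟩, fun j hj => Function.update_of_ne hj _ _, by simpa⟩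
  rw [← hus', Finset.coe_insert, htv]
  ext z
  constructor
  · rintro ⟨j, rfl⟩
    by_cases hj : j = i
    · subst hj; simp
    · rw [Function.update_of_ne hj]
      exact Or.inr ⟨j, hj, rfl⟩
  · rintro (rfl | ⟨j, hj, rfl⟩)
    · exact ⟨i, by simp⟩
    · exact ⟨j, Function.update_of_ne hj _ _⟩

lemma exists_affineMap_eqOn {m : ℕ} {Φ : Euc n → Euc m} (hΦ : IsSimplicialMap K Φ)
    {v : Fin (d + 1) → Euc n} (hv : IsVertexOrdering K v) :
    ∃ A : Euc n →ᵃ[ℝ] Euc m, EqOn Φ A (convexHull ℝ (range v)) ∧ Φ ∘ v = A ∘ v := by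
  obtain ⟨s, hs, h⟩ := hv
  obtain ⟨A, hA⟩ := hΦ.affine s hs.1
  rw [← h] at hA
  exact ⟨A, hA, funext fun i => hA (subset_convexHull ℝ _ (mem_range_self i))⟩

lemma image_convexHull_ordering {m : ℕ} {Φ : Euc n → Euc m} (hΦ : IsSimplicialMap K Φ)
    {v : Fin (d + 1) → Euc n} (hv : IsVertexOrdering K v) :
    Φ '' convexHull ℝ (range v) = convexHull ℝ (range (Φ ∘ v)) := by
  obtain ⟨A, hA, hAv⟩ := exists_affineMap_eqOn hΦ hv
  rw [hA.image_eq, AffineMap.image_convexHull, hAv, range_comp]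

lemma convexHull_range_subset_space {v : Fin (d + 1) → Euc n} (hv : IsVertexOrdering K v) :
    convexHull ℝ (range v) ⊆ K.space := by
  obtain ⟨s, hs, h⟩ := hv
  rw [h]
  exact SimplicialComplex.convexHull_subset_space hs.1

/-- A point of a simplex whose image has a vanishing barycentric coordinate lies on the
corresponding facet. -/
lemma mem_facet_of_coord_eq_zero {Φ : Euc n → Euc d} (hΦ : IsSimplicialMap K Φ)
    {v : Fin (d + 1) → Euc n} (hv : IsVertexOrdering K v)
    (hdet : (homogMatrix (Φ ∘ v)).det ≠ 0) {x : Euc n} (hx : x ∈ convexHull ℝ (range v))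
    {i : Fin (d + 1)} (hi : (basisOfDet (Φ ∘ v) hdet).coord i (Φ x) = 0) :
    x ∈ convexHull ℝ (v '' {i}ᶜ) := by
  classical
  obtain ⟨A, hA, hAv⟩ := exists_affineMap_eqOn hΦ hv
  have hx' := hx
  rw [convexHull_range_eq_exists_affineCombination] at hx'
  obtain ⟨s, w, hw0, hw1, hxw⟩ := hx'
  have hΦx : Φ x = s.affineCombination ℝ (basisOfDet (Φ ∘ v) hdet) w := by
    rw [hA hx, ← hxw, Finset.map_affineCombination _ _ _ hw1, coe_basisOfDet, hAv]
  have hwk : ∀ k ∈ s, k ∉ s.erase i → w k = 0 := by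
    intro k hk hki
    obtain rfl : k = i := by
      by_contra h
      exact hki (Finset.mem_erase.2 ⟨h, hk⟩)
    rwa [hΦx, AffineBasis.coord_apply_combination_of_mem _ hk hw1] at hi
  rw [← hxw, Finset.affineCombination_eq_linear_combination _ _ _ hw1,
    ← Finset.sum_subset (Finset.erase_subset i s) fun k hk hki => by rw [hwk k hk hki, zero_smul]]
  refine (convex_convexHull ℝ _).sum_mem (fun k hk => hw0 k (Finset.mem_of_mem_erase hk)) ?_
    fun k hk => subset_convexHull ℝ _ ⟨k, Finset.ne_of_mem_erase hk, rfl⟩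
  rw [Finset.sum_subset (Finset.erase_subset i s) hwk, hw1]

variable (K d) in
/-- The vertex orderings of the `d`-faces containing `x`. -/
def starOrderings (x : Euc n) : Set (Fin (d + 1) → Euc n) :=
  {v | IsVertexOrdering K v ∧ x ∈ convexHull ℝ (range v)}

lemma finite_starOrderings (hfin : K.faces.Finite) (x : Euc n) :
    (starOrderings K d x).Finite := by
  have hV : (⋃ s ∈ K.faces, (s : Set (Euc n))).Finite :=
    hfin.biUnion fun s _ => s.finite_toSet
  refine (Set.Finite.pi' fun _ : Fin (d + 1) => hV).subset ?_
  rintro v ⟨⟨s, hs, h⟩, -⟩ i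
  exact mem_biUnion hs.1 (h ▸ mem_range_self i)

/-- The image of the closed star of an interior point is a neighbourhood of its image. -/
lemma image_star_mem_nhds [NeZero d] (hfin : K.faces.Finite)
    (hpure : ∀ s ∈ K.faces, ∃ t ∈ facesOfDim K d, s ⊆ t)
    {o : ConsistentOrientation K d} {Φ : Euc n → Euc d} (hΦ : IsSimplicialMap K Φ)
    (hor : IsOrientationPreserving o Φ) {x : Euc n} (hx : x ∈ meshInterior K d) :
    ⋃ v : starOrderings K d x, convexHull ℝ (range (Φ ∘ v.1)) ∈ 𝓝 (Φ x) := by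
  have : Finite (starOrderings K d x) := finite_starOrderings hfin x
  have : Nonempty (starOrderings K d x) := by
    obtain ⟨s, hs, hxs⟩ := SimplicialComplex.mem_space_iff.1 hx.1
    obtain ⟨t, ht, hst⟩ := hpure s hs
    obtain ⟨v, hv, h⟩ := exists_vertexOrdering ht
    exact ⟨v, hv, h ▸ convexHull_mono (Finset.coe_subset.2 hst) hxs⟩
  refine iUnion_convexHull_mem_nhds
    (fun v : starOrderings K d x => basisOfDet (Φ ∘ v.1) (homogMatrix_det_ne_zero hor v.2.1))
    (Φ x) (fun v => ?_) fun v i hi => ?_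
  · rw [coe_basisOfDet, ← image_convexHull_ordering hΦ v.2.1]
    exact mem_image_of_mem Φ v.2.2
  · have hxi := mem_facet_of_coord_eq_zero hΦ v.2.1 _ v.2.2 hi
    obtain ⟨w, hw, hwv, hwi⟩ := exists_adjacent hx.2 v.2.1 hxi
    refine ⟨⟨w, hw, convexHull_mono ?_ hxi⟩, fun j hj => ?_, ?_⟩
    · rintro _ ⟨j, hj, rfl⟩
      exact ⟨j, hwv j hj⟩
    · simp [hwv j hj]
    · exact coord_neg_of_adjacent hor v.2.1 hw hwv hwi

/-- Small homothetic copies of a bounded set enter every neighbourhood of the centre. -/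
lemma exists_homothety_mapsTo {E : Type*} [NormedAddCommGroup E] [NormedSpace ℝ E] {S V : Set E}
    {x : E} (hS : Bornology.IsBounded S) (hV : V ∈ 𝓝 x) :
    ∃ t ∈ Ioo (0 : ℝ) 1, MapsTo (AffineMap.homothety x t) S V := by
  obtain ⟨ε, hε, hεV⟩ := Metric.mem_nhds_iff.1 hV
  obtain ⟨R, hR, hSR⟩ := hS.subset_closedBall_lt 0 x
  refine ⟨ε / (ε + R), ⟨by positivity, by rw [div_lt_one] <;> linarith⟩, fun z hz => hεV ?_⟩
  have hz' := hSR hz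
  rw [Metric.mem_closedBall] at hz'
  rw [Metric.mem_ball, dist_comm, dist_center_homothety, Real.norm_of_nonneg (by positivity),
    dist_comm, div_mul_eq_mul_div, div_lt_iff₀ (by positivity)]
  nlinarith

theorem image_mem_nhds_of_mem_meshInterior [NeZero d] (hfin : K.faces.Finite)
    (hpure : ∀ s ∈ K.faces, ∃ t ∈ facesOfDim K d, s ⊆ t)
    {o : ConsistentOrientation K d} {Φ : Euc n → Euc d} (hΦ : IsSimplicialMap K Φ)
    (hor : IsOrientationPreserving o Φ) {x : Euc n} (hx : x ∈ meshInterior K d) {V : Set (Euc n)}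
    (hV : V ∈ 𝓝 x) : Φ '' (V ∩ meshInterior K d) ∈ 𝓝 (Φ x) := by
  have hV' : V ∩ (meshBoundary K d)ᶜ ∈ 𝓝 x :=
    Filter.inter_mem hV ((isClosed_meshBoundary hfin).isOpen_compl.mem_nhds hx.2)
  have hfinT := finite_starOrderings (d := d) hfin x
  obtain ⟨t, ⟨ht0, ht1⟩, ht⟩ := exists_homothety_mapsTo
    (S := ⋃ v ∈ starOrderings K d x, convexHull ℝ (range v))
    ((Bornology.isBounded_biUnion hfinT).2 fun v _ =>
      ((finite_range v).isCompact_convexHull ℝ).isBounded) hV'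
  have hC := (AffineMap.homothety_isOpenMap (Φ x) t ht0.ne').image_mem_nhds
    (image_star_mem_nhds hfin hpure hΦ hor hx)
  rw [AffineMap.homothety_apply_same] at hC
  refine Filter.mem_of_superset hC ?_
  rintro _ ⟨p, hp, rfl⟩
  obtain ⟨⟨v, hv⟩, hp⟩ := mem_iUnion.1 hp
  simp only [← image_convexHull_ordering hΦ hv.1] at hp
  obtain ⟨z, hz, rfl⟩ := hp
  obtain ⟨A, hA, -⟩ := exists_affineMap_eqOn hΦ hv.1
  have hmem : AffineMap.homothety x t z ∈ convexHull ℝ (range v) := by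
    rw [AffineMap.homothety_eq_lineMap]
    exact (convex_convexHull ℝ _).lineMap_mem hv.2 hz ⟨ht0.le, ht1.le⟩
  have hm := ht (mem_biUnion hv hz)
  refine ⟨AffineMap.homothety x t z, ⟨hm.1, convexHull_range_subset_space hv.1 hmem, hm.2⟩, ?_⟩
  rw [hA hmem, hA hv.2, hA hz, AffineMap.homothety_eq_lineMap, AffineMap.homothety_eq_lineMap,
    AffineMap.apply_lineMap]

end Mesh

end SimplicialMesh

open SimplicialMesh in
theorem mainTheorem6 {n d : ℕ} [NeZero d] (hdn : d ≤ n)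
    (K : Geometry.SimplicialComplex ℝ (Euc n)) (hK : IsManifoldMesh K d)
    (o : ConsistentOrientation K d) (Φ : Euc n → Euc d)
    (hΦ : IsSimplicialMap K Φ) (hnd : IsNondegenerate K Φ)
    (hor : IsOrientationPreserving o Φ) :
    IsOpenMap (fun x : meshInterior K d => Φ x) := by
  rw [isOpenMap_iff_nhds_le]
  intro x U hU
  rw [Filter.mem_map] at hU
  obtain ⟨V, hV, hVU⟩ := mem_nhds_subtype _ _ _ |>.1 hU
  refine Filter.mem_of_superset
    (image_mem_nhds_of_mem_meshInterior hK.finite hK.pure hΦ hor x.2 hV) ?_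
  rintro _ ⟨z, ⟨hz, hzi⟩, rfl⟩
  exact @hVU ⟨z, hzi⟩ hz
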